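/- There is an absolute constant $K>0$ with the following property. Let $\mathcal Y\subseteq[0,1]^d$ be nonempty and convex, let $\mathcal X$ be a set of contexts, $\mathcal A$ a finite set of actions, $L\ge 0$ and $T\ge 1$. Let $\mathcal L$ be a finite family of losses $\ell:\mathcal A\times\mathcal Y\to[0,1]$ such that for every $a\in\mathcal A$ the map $\ell(a,\cdot)$ is linear, $\ell(a,y)=\sum_{i=1}^d r_i^\ell(a)\,y_i$, and $L$-Lipschitz in $\|\cdot\|_\infty$ on $\mathcal Y$. Let $\mathcal C$ be a finite collection of policies $c:\mathcal X\to\mathcal A$. For $\ell\in\mathcal L$ let $\mathrm{BR}^\ell(p)\in\operatorname{argmin}_{a\in\mathcal A}\ell(a,p)$ be the best response to $p\in\mathcal Y$, with an arbitrary measurable tie-breaking rule. **Decision-Swap.** Let $\mathcal E$ be the collection of the events $\mathbb 1[\mathrm{BR}^\ell(p)=a]$ and $\mathbb 1[\mathrm{BR}^\ell(p)=a,\ c(x)=b]$ with $\ell\in\mathcal L$, $a,b\in\mathcal A$, $c\in\mathcal C$, regarded as functions of $(x,p)\in\mathcal X\times\mathcal Y$ and indexed by these parameters. Let $0<\tau\le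 1/T$ and $H=\{1,\tfrac12,\tfrac14,\dots,2^{-\lfloor\log_2T\rfloor}\}$. In round $t=1,\dots,T$ the algorithm observes $x_t$; for $E\in\mathcal E$, $i\in[d]$, $\sigma\in\{\pm1\}$ it forms the signed biases $g_s^{E,i,\sigma}=\sigma\,\mathbb E_{p\sim\pi_s}[E(x_s,p)(p^i-y_s^i)]$ of the rounds $s<t$ and the distribution $$q_t^{E,i,\sigma}\ \propto\ \sum_{\eta\in H}\eta\,\exp\Big(\frac{\eta}{2}\sum_{s<t}g_s^{E,i,\sigma}-\frac{\eta^2}{4}\sum_{s<t}\big(g_s^{E,i,\sigma}\big)^2\Big),$$ and it outputs a probability distribution $\pi_t\in\Delta\mathcal Y$, determined by $x_1,\dots,x_t$ and $y_1,\dots,y_{t-1}$, that minimizes $$\sup_{y\in\mathcal Y}\ \mathbb E_{p\sim\pi}\Big[\sum_{E,i,\sigma}q_t^{E,i,\sigma}\,\sigma\,E(x_t,p)\,(p^i-y^i)\Big]$$ over $\pi\in\Delta\mathcal Y$ up to an additive error of at most $\tau$. Then $y_t\in\mathcal Y$ is revealed. Such an algorithm exists, and, for every way of choosing the approximate minimizers,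 all contexts $x_1,\dots,x_T\in\mathcal X$ and all outcomes $y_1,\dots,y_T\in\mathcal Y$, its predictions have expected $(\mathcal L,\mathcal C,\varepsilon)$-decision swap regret with $$\varepsilon=K\,L\,|\mathcal A|\sqrt{\frac{\ln(d|\mathcal A||\mathcal L||\mathcal C|T)}{T}}$$ when agents best respond: for every $\ell\in\mathcal L$ and every assignment of policies $\{c_a\in\mathcal C\}_{a\in\mathcal A}$, with $a_t=\mathrm{BR}^\ell(p_t)$ and independent $p_t\sim\pi_t$, $$\mathbb E\Big[\frac1T\sum_{t=1}^T\big(\ell(a_t,y_t)-\ell(c_{a_t}(x_t),y_t)\big)\Big]\le\varepsilon .$$ (Here $\ln 0$ is read as $0$ in the trivial case where the argument vanishes.) -/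

import Mathlib

open MeasureTheory

universe u v

noncomputable section

/-- A loss `ℓ : 𝒜 × 𝒴 → [0,1]` on an outcome space `Y ⊆ ℝ^d` that is linear in the outcome
and `lip`-Lipschitz in the outcome for the `L_∞` norm (the norm of `Fin d → ℝ`). -/
structure IsLinearLoss {d : ℕ} {Y : Set (Fin d → ℝ)} {A : Type v} (lip : ℝ)
    (ℓ : A → Y → ℝ) : Prop where
  nonneg : ∀ a y, 0 ≤ ℓ a y
  le_one : ∀ a y, ℓ a y ≤ 1
  linear : ∃ r : A → Fin d → ℝ, ∀ a (y : Y), ℓ a y = ∑ i, r a i * (y : Fin d → ℝ) i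
  lipschitz : ∀ a (y y' : Y),
    |ℓ a y - ℓ a y'| ≤ lip * ‖(y : Fin d → ℝ) - (y' : Fin d → ℝ)‖

/-- `k` is a best response rule for the loss `ℓ`: `k p ∈ argmin_a ℓ(a, p)` for all `p`,
with ties broken in some measurable way. -/
structure IsBestResponse {d : ℕ} {Y : Set (Fin d → ℝ)} {A : Type v}
    (ℓ : A → Y → ℝ) (k : Y → A) : Prop where
  argmin : ∀ p a, ℓ (k p) p ≤ ℓ a p
  measurable : ∀ a, MeasurableSet {p : Y | k p = a}

/-- The average regret, over `T` rounds with contexts `x`, outcomes `y` and realized predictions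
`p`, of an agent with loss `ℓ` who plays `a_t = k (p_t)`, against the policies `(c_a)_a`. -/
def swapRegret {d : ℕ} {Y : Set (Fin d → ℝ)} {X : Type u} {A : Type v} (T : ℕ)
    (ℓ : A → Y → ℝ) (k : Y → A) (c : A → X → A) (x : ℕ → X) (y : ℕ → Y)
    (p : Fin T → Y) : ℝ :=
  (1 / (T : ℝ)) * ∑ t : Fin T, (ℓ (k (p t)) (y t) - ℓ (c (k (p t)) (x t)) (y t))

/-- `(𝓛, 𝒞, ε)`-decision swap regret, in expectation over independent predictions `p_t ∼ π_t`,
when an agent with loss `ℓ` uses the action selection rule `k ℓ`. -/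
def HasExpectedDecisionSwapRegret {d : ℕ} {Y : Set (Fin d → ℝ)} {X : Type u} {A : Type v}
    (T : ℕ) (𝓛 : Finset (A → Y → ℝ)) (𝒞 : Finset (X → A)) (k : (A → Y → ℝ) → Y → A)
    (x : ℕ → X) (y : ℕ → Y) (π : ℕ → ProbabilityMeasure Y) (ε : ℝ) : Prop :=
  ∀ ℓ ∈ 𝓛, ∀ c : A → X → A, (∀ a, c a ∈ 𝒞) →
    ∫ p : Fin T → Y, swapRegret T ℓ (k ℓ) c x y p
      ∂(Measure.pi fun t : Fin T => (π t : Measure Y)) ≤ ε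

/-! ### The algorithm Unbiased-Prediction -/

/-- An online forecaster: in round `t` (counted from `0`) it maps the past contexts and outcomes
and the current context to a distribution over predictions in `Y`. -/
abbrev Forecaster {d : ℕ} (X : Type u) (Y : Set (Fin d → ℝ)) :=
  (t : ℕ) → (Fin t → X × Y) → X → ProbabilityMeasure Y

/-- The distribution `π_t` output in round `t` on the context sequence `x` and outcome
sequence `y`. -/
def Forecaster.play {d : ℕ} {X : Type u} {Y : Set (Fin d → ℝ)} (F : Forecaster X Y)
    (x : ℕ → X) (y : ℕ → Y) (t : ℕ) : ProbabilityMeasure Y :=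
  F t (fun s => (x s, y s)) (x t)

/-- The signed conditional bias `σ · 𝔼_{p ∼ π}[E(x, p) (pⁱ - yⁱ)]` of one round. -/
def signedBias {d : ℕ} {X : Type u} {Y : Set (Fin d → ℝ)} (E : X → Y → ℝ) (i : Fin d) (σ : ℤˣ)
    (x : X) (π : ProbabilityMeasure Y) (y : Y) : ℝ :=
  ((σ : ℤ) : ℝ) *
    ∫ p : Y, E x p * ((p : Fin d → ℝ) i - (y : Fin d → ℝ) i) ∂(π : Measure Y)

/-- Unnormalized weight of the triple (event, coordinate, sign) after `t` rounds. With a single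
learning rate, `H = {η}`, and no second-order correction, `κ = 0`, it is proportional to
`exp ((η / 2) ∑_{s < t} σ 𝔼[E(x_s, p_s) (p_sⁱ - y_sⁱ)])`. -/
def rawWeight {d : ℕ} {X : Type u} {Y : Set (Fin d → ℝ)} (H : Finset ℝ) (κ : ℝ)
    (x : ℕ → X) (π : ℕ → ProbabilityMeasure Y) (y : ℕ → Y) (t : ℕ)
    (E : X → Y → ℝ) (i : Fin d) (σ : ℤˣ) : ℝ :=
  ∑ η ∈ H, η * Real.exp
    ((η / 2) * ∑ s ∈ Finset.range t, signedBias E i σ (x s) (π s) (y s)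
      - κ * (η / 2) ^ 2 * ∑ s ∈ Finset.range t, signedBias E i σ (x s) (π s) (y s) ^ 2)

/-- The distribution `q_t` over triples (event, coordinate, sign). -/
def weight {d : ℕ} {X : Type u} {Y : Set (Fin d → ℝ)} {ι : Type*} [Fintype ι]
    (H : Finset ℝ) (κ : ℝ) (E : ι → X → Y → ℝ)
    (x : ℕ → X) (π : ℕ → ProbabilityMeasure Y) (y : ℕ → Y) (t : ℕ)
    (e : ι) (i : Fin d) (σ : ℤˣ) : ℝ :=
  rawWeight H κ x π y t (E e) i σ /
    ∑ e' : ι, ∑ i' : Fin d, ∑ σ' : ℤˣ, rawWeight H κ x π y t (E e') i' σ'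

/-- The objective `𝔼_{p ∼ π} ∑_{E,i,σ} q(E,i,σ) σ E(x,p) (pⁱ - yⁱ)` of the min-max problem. -/
def objective {d : ℕ} {X : Type u} {Y : Set (Fin d → ℝ)} {ι : Type*} [Fintype ι]
    (q : ι → Fin d → ℤˣ → ℝ) (E : ι → X → Y → ℝ) (x : X)
    (π : ProbabilityMeasure Y) (y : Y) : ℝ :=
  ∫ p : Y, ∑ e : ι, ∑ i : Fin d, ∑ σ : ℤˣ,
    q e i σ * ((σ : ℤ) : ℝ) * E e x p * ((p : Fin d → ℝ) i - (y : Fin d → ℝ) i) ∂(π : Measure Y)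

/-- `F` runs Unbiased-Prediction for `T` rounds with the events `E`: in every round it outputs a
distribution that minimizes `max_y objective` up to an additive error `τ`. -/
def IsUnbiasedPrediction {d : ℕ} {X : Type u} {Y : Set (Fin d → ℝ)} {ι : Type*} [Fintype ι]
    (T : ℕ) (τ : ℝ) (H : Finset ℝ) (κ : ℝ) (E : ι → X → Y → ℝ) (F : Forecaster X Y) : Prop :=
  ∀ (x : ℕ → X) (y : ℕ → Y), ∀ t < T, ∀ π' : ProbabilityMeasure Y,
    (⨆ y' : Y, objective (weight H κ E x (F.play x y) y t) E (x t) (F.play x y t) y') ≤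
      (⨆ y' : Y, objective (weight H κ E x (F.play x y) y t) E (x t) π' y') + τ

/-! ### The instantiation Decision-Swap -/

open Classical in
/-- The events `1[BR^ℓ(p) = a]` and `1[BR^ℓ(p) = a, c(x) = b]`, where `BR^ℓ = k ℓ`. -/
def decisionEvent {d : ℕ} {Y : Set (Fin d → ℝ)} {X : Type u} {A : Type v}
    (𝓛 : Finset (A → Y → ℝ)) (𝒞 : Finset (X → A)) (k : (A → Y → ℝ) → Y → A) :
    (𝓛 × A) ⊕ (𝓛 × A × A × 𝒞) → X → Y → ℝ
  | .inl (ℓ, a), _, p => if k ℓ p = a then 1 else 0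
  | .inr (ℓ, a, b, c), x, p => if k ℓ p = a ∧ (c : X → A) x = b then 1 else 0

/-- The learning rates `1, 1/2, 1/4, …, 2^{-⌊log₂ T⌋}`. -/
def dyadicRates (T : ℕ) : Finset ℝ :=
  (Finset.range (Nat.log 2 T + 1)).image fun j => ((1 : ℝ) / 2) ^ j

/-- `F` runs Decision-Swap: Unbiased-Prediction with the decision events, dyadic learning rates
and second-order correction. -/
def IsDecisionSwap {d : ℕ} {Y : Set (Fin d → ℝ)} {X : Type u} {A : Type v} [Fintype A]
    (T : ℕ) (τ : ℝ) (𝓛 : Finset (A → Y → ℝ)) (𝒞 : Finset (X → A))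
    (k : (A → Y → ℝ) → Y → A) (F : Forecaster X Y) : Prop :=
  IsUnbiasedPrediction T τ (dyadicRates T) 1 (decisionEvent 𝓛 𝒞 k) F

end

/-! The forecaster is calibrated only on the events that the regret uses. Since a best response is
optimal at the prediction, its regret on the outcome is at most a sum of biases: one for each event
"play a" and one for each event "play a while the comparison policy says b". It remains to bound
each cumulative bias by Λ + √(Λ n), up to constants, with Λ logarithmic and n the expected number of
occurrences of the event (`IsUnbiasedPrediction.abs_sum_bias_le`).

Two facts give that bound. The min-max game has value at most 0: a mixture of outcomes is answered
by predicting its mean, where the bilinear payoff vanishes (`exists_forall_integral_le`). Hence the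
weighted bias of each round is at most τ. Multiplicative weights with second-order correction turn
this into a bound on every single bias (`exp_le_of_secondOrder_weights`), and the dyadic grid
contains a nearly optimal rate for every event (`le_of_forall_dyadicRates`).

For a fixed loss and assignment of policies the events partition each round, so the counts add up to
T. Cauchy–Schwarz over |A|² events then gives |A|√(ΛT) (`sum_sqrt_bound`), with no further factor of
|A|. The factor L, free of d, arises because cumulative biases lie in the span of differences of
`Y`, where the Lipschitz bound controls the loss (`abs_sum_mul_bias_le`). -/

noncomputable section

/-! ### The min-max game, by separation on finitely many outcomes and a finite net. -/

section Minimax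

variable {d : ℕ} {Y : Set (Fin d → ℝ)}

lemma measurable_coe_apply (i : Fin d) : Measurable fun p : Y => (p : Fin d → ℝ) i :=
  (measurable_pi_apply i).comp measurable_subtype_coe

lemma abs_apply_sub_apply_le_one (hY : Y ⊆ Set.Icc 0 1) (p y : Y) (i : Fin d) :
    |(p : Fin d → ℝ) i - (y : Fin d → ℝ) i| ≤ 1 := by
  have hp := hY p.2
  have hy := hY y.2
  have h1 := hp.1 i
  have h2 := hp.2 i
  have h3 := hy.1 i
  have h4 := hy.2 i
  simp only [Pi.zero_apply, Pi.one_apply] at h1 h2 h3 h4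
  rw [abs_le]
  constructor <;> linarith

lemma integrable_of_abs_le {Ω : Type*} [MeasurableSpace Ω] (μ : Measure Ω) [IsFiniteMeasure μ]
    {f : Ω → ℝ} (hf : Measurable f) {B : ℝ} (hB : ∀ p, |f p| ≤ B) : Integrable f μ :=
  Integrable.of_bound hf.aestronglyMeasurable B (Filter.Eventually.of_forall hB)

/-- The convex combination of two probability measures, tested against a bounded function. -/
lemma ProbabilityMeasure.exists_integral_eq_convexCombo {Ω : Type*} [MeasurableSpace Ω]
    (μ ν : ProbabilityMeasure Ω) {a b : ℝ} (ha : 0 ≤ a) (hb : 0 ≤ b) (hab : a + b = 1) :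
    ∃ π : ProbabilityMeasure Ω, ∀ (f : Ω → ℝ) (B : ℝ), Measurable f → (∀ p, |f p| ≤ B) →
      ∫ p, f p ∂(π : Measure Ω) = a * ∫ p, f p ∂(μ : Measure Ω) + b * ∫ p, f p ∂(ν : Measure Ω) := by
  refine ⟨⟨ENNReal.ofReal a • (μ : Measure Ω) + ENNReal.ofReal b • (ν : Measure Ω), ⟨?_⟩⟩, ?_⟩
  · simp [← ENNReal.ofReal_add ha hb, hab]
  · intro f B hf hB
    have h1 := (integrable_of_abs_le (μ : Measure Ω) hf hB).smul_measure (ENNReal.ofReal_ne_top (r := a))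
    have h2 := (integrable_of_abs_le (ν : Measure Ω) hf hB).smul_measure (ENNReal.ofReal_ne_top (r := b))
    simp only [ProbabilityMeasure.coe_mk]
    rw [integral_add_measure h1 h2, integral_smul_measure, integral_smul_measure,
      ENNReal.toReal_ofReal ha, ENNReal.toReal_ofReal hb, smul_eq_mul, smul_eq_mul]

/-- Against finitely many outcomes, some distribution has small expected bilinear payoff. -/
lemma exists_integral_lt_of_finset (hYc : Convex ℝ Y) (hYn : Y.Nonempty) (hY : Y ⊆ Set.Icc 0 1)
    {u : Y → Fin d → ℝ} (hu : ∀ i, Measurable fun p => u p i) {B : ℝ} (hB : ∀ p i, |u p i| ≤ B)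
    (s : Finset Y) {δ : ℝ} (hδ : 0 < δ) :
    ∃ π : ProbabilityMeasure Y, ∀ y ∈ s,
      ∫ p, ∑ i, u p i * ((p : Fin d → ℝ) i - (y : Fin d → ℝ) i) ∂(π : Measure Y) < δ := by
  classical
  set φ : Y → Y → ℝ := fun p y => ∑ i, u p i * ((p : Fin d → ℝ) i - (y : Fin d → ℝ) i) with hφ
  have hm : ∀ y, Measurable fun p => φ p y := fun y =>
    Finset.measurable_sum _ fun i _ => (hu i).mul ((measurable_coe_apply i).sub_const _)
  have hb : ∀ y p, |φ p y| ≤ d * B := fun y p => by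
    refine (Finset.abs_sum_le_sum_abs _ _).trans ?_
    refine (Finset.sum_le_sum (g := fun _ => B) fun i _ => ?_).trans (by simp)
    rw [abs_mul]
    have := hB p i
    have h0 := (abs_nonneg (u p i)).trans this
    calc _ ≤ B * 1 := mul_le_mul this (abs_apply_sub_apply_le_one hY p y i) (abs_nonneg _) h0
      _ = B := mul_one B
  by_contra! hcon
  -- If no distribution works, the convex set `R` of payoff vectors misses the open orthant `O`. A
  -- separating functional will act as a mixed strategy of the outcome player.
  let O : Set (s → ℝ) := Set.pi Set.univ fun _ => Set.Iio δ
  let R : Set (s → ℝ) := Set.range fun (π : ProbabilityMeasure Y) (y : s) =>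
    ∫ p, φ p y ∂(π : Measure Y)
  have hOc : Convex ℝ O := convex_pi fun _ _ => convex_Iio δ
  have hOo : IsOpen O := isOpen_set_pi Set.finite_univ fun _ _ => isOpen_Iio
  have hRc : Convex ℝ R := by
    rintro _ ⟨μ, rfl⟩ _ ⟨ν, rfl⟩ a b ha hb' hab
    obtain ⟨π, hπ⟩ := ProbabilityMeasure.exists_integral_eq_convexCombo μ ν ha hb' hab
    refine ⟨π, funext fun y => ?_⟩
    simpa using hπ _ _ (hm y) (hb y)
  have hdis : Disjoint O R := by
    rw [Set.disjoint_left]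
    rintro _ hz ⟨π, rfl⟩
    obtain ⟨y, hy, hle⟩ := hcon π
    exact absurd (hz ⟨y, hy⟩ trivial) (not_lt.2 hle)
  obtain ⟨f, c, hfO, hfR⟩ := geometric_hahn_banach_open hOc hOo hRc hdis
  have hc : 0 < c := by
    have := hfO 0 (fun _ _ => hδ)
    simpa using this
  set w : s → ℝ := fun j => f (Pi.single j 1) with hw
  have hf : ∀ z, f z = ∑ j, z j * w j := fun z => by
    conv_lhs => rw [← Finset.univ_sum_single z]
    rw [map_sum]
    refine Finset.sum_congr rfl fun j _ => ?_
    have : (Pi.single j (z j) : s → ℝ) = z j • Pi.single j (1 : ℝ) := by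
      rw [← Pi.single_smul]; simp
    simp [this, hw]
  -- `O` is unbounded below in each coordinate, so a negative weight would let `f` reach `c` on `O`.
  have hw0 : ∀ j, 0 ≤ w j := fun j => by
    by_contra! hneg
    have hs : (0 : ℝ) ≤ c / (-w j) := div_nonneg hc.le (by linarith)
    have := hfO ((-(c / (-w j))) • Pi.single j (1 : ℝ)) (fun k _ => by
      by_cases hk : k = j
      · subst hk; simp only [Pi.smul_apply, Pi.single_eq_same, smul_eq_mul, mul_one, Set.mem_Iio]
        linarith
      · simp [hk, hδ])
    rw [map_smul, smul_eq_mul] at this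
    have e : -(c / (-w j)) * w j = c := by
      have := hneg.ne
      field_simp
    exact absurd this (by rw [show f (Pi.single j 1) = w j from rfl, e]; exact lt_irrefl c)
  have hdir : ∀ p : Y, c ≤ ∑ j : s, φ p j * w j := fun p => by
    rw [← hf fun j : s => φ p j]
    refine hfR _ ⟨⟨Measure.dirac p, inferInstance⟩, ?_⟩
    funext y
    simp
  obtain ⟨y₀, hy₀⟩ := hYn
  have hW : 0 < ∑ j, w j := by
    refine lt_of_le_of_ne (Finset.sum_nonneg fun j _ => hw0 j) fun h => ?_
    have h0 := (Finset.sum_eq_zero_iff_of_nonneg fun j _ => hw0 j).1 h.symm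
    have := hdir ⟨y₀, hy₀⟩
    rw [Finset.sum_eq_zero fun j hj => by rw [h0 j hj, mul_zero]] at this
    linarith
  -- Predicting the barycentre of the mixed outcome makes the weighted payoff zero, contradicting
  -- `hdir` and `0 < c`.
  have hmem : Finset.univ.centerMass w (fun j : s => ((j : Y) : Fin d → ℝ)) ∈ Y :=
    hYc.centerMass_mem (fun j _ => hw0 j) hW fun j _ => (j : Y).2
  have := hdir ⟨_, hmem⟩
  have hz : ∑ j : s, φ ⟨_, hmem⟩ j * w j = 0 := by
    simp only [hφ, Finset.sum_mul]
    rw [Finset.sum_comm]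
    refine Finset.sum_eq_zero fun i _ => ?_
    simp only [mul_assoc, ← Finset.mul_sum, sub_mul, Finset.sum_sub_distrib]
    simp only [Finset.centerMass, Pi.smul_apply, Finset.sum_apply, smul_eq_mul]
    rw [mul_comm _ (∑ j, w j), ← mul_assoc, mul_inv_cancel₀ hW.ne', one_mul]
    simp [mul_comm]
  linarith

/-- The value of the bilinear game is nonpositive: `p` may be distributed so that the expected
payoff is small against every outcome. -/
lemma exists_forall_integral_le (hYc : Convex ℝ Y) (hYn : Y.Nonempty) (hY : Y ⊆ Set.Icc 0 1)
    {u : Y → Fin d → ℝ} (hu : ∀ i, Measurable fun p => u p i) {B : ℝ} (hB : ∀ p i, |u p i| ≤ B)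
    {δ : ℝ} (hδ : 0 < δ) :
    ∃ π : ProbabilityMeasure Y, ∀ y : Y,
      ∫ p, ∑ i, u p i * ((p : Fin d → ℝ) i - (y : Fin d → ℝ) i) ∂(π : Measure Y) ≤ δ := by
  classical
  -- Moving the outcome by `r` changes the payoff by at most `d * |B| * r ≤ δ / 2`; the `+ 1` keeps
  -- the denominator positive.
  set r : ℝ := δ / (2 * (d * |B| + 1)) with hr
  have hD : 0 < d * |B| + 1 := by positivity
  have hr0 : 0 < r := by positivity
  have htb : TotallyBounded Y :=
    (isCompact_Icc (a := (0 : Fin d → ℝ)) (b := 1)).totallyBounded.subset hY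
  obtain ⟨t, htY, htf, hcov⟩ := Metric.finite_approx_of_totallyBounded htb r hr0
  obtain ⟨π, hπ⟩ := exists_integral_lt_of_finset hYc hYn hY hu hB
    (htf.preimage (Subtype.val_injective.injOn (s := (Subtype.val : Y → _) ⁻¹' t))).toFinset
    (half_pos hδ)
  refine ⟨π, fun y => ?_⟩
  obtain ⟨z, hz, hyz⟩ := Set.mem_iUnion₂.1 (hcov y.2)
  have h1 := hπ ⟨z, htY hz⟩ (by simpa using hz)
  have hint : ∀ y : Y, Integrable
      (fun p : Y => ∑ i, u p i * ((p : Fin d → ℝ) i - (y : Fin d → ℝ) i)) (π : Measure Y) := by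
    intro y
    refine integrable_finsetSum _ fun i _ => integrable_of_abs_le _ (B := B * 1)
      ((hu i).mul ((measurable_coe_apply i).sub_const _)) fun p => ?_
    rw [abs_mul]
    exact mul_le_mul (hB p i) (abs_apply_sub_apply_le_one hY p y i) (abs_nonneg _)
      ((abs_nonneg _).trans (hB p i))
  have h2 : ∫ p, ∑ i, u p i * ((p : Fin d → ℝ) i - (y : Fin d → ℝ) i) ∂(π : Measure Y) ≤
      ∫ p, (∑ i, u p i * ((p : Fin d → ℝ) i - z i)) + δ / 2 ∂(π : Measure Y) := by
    refine integral_mono (hint y) ((hint ⟨z, htY hz⟩).add (integrable_const _)) fun p => ?_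
    have h3 : ∑ i, u p i * (z i - (y : Fin d → ℝ) i) ≤ ∑ _i : Fin d, |B| * r := by
      refine Finset.sum_le_sum fun i _ => (le_abs_self _).trans ?_
      rw [abs_mul]
      refine mul_le_mul ((hB p i).trans (le_abs_self B)) ?_ (abs_nonneg _) (abs_nonneg _)
      rw [abs_sub_comm, ← Real.dist_eq]
      exact (dist_le_pi_dist _ _ i).trans (Metric.mem_ball.1 hyz).le
    have h4 : ∑ _i : Fin d, |B| * r ≤ δ / 2 := by
      simp only [Finset.sum_const, Finset.card_univ, Fintype.card_fin, nsmul_eq_mul]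
      have : (d * |B| + 1) * r = δ / 2 := by rw [hr]; field_simp
      nlinarith
    have h5 : ∑ i, u p i * ((p : Fin d → ℝ) i - (y : Fin d → ℝ) i) =
        ∑ i, u p i * ((p : Fin d → ℝ) i - z i) + ∑ i, u p i * (z i - (y : Fin d → ℝ) i) := by
      rw [← Finset.sum_add_distrib]
      exact Finset.sum_congr rfl fun i _ => by ring
    show ∑ i, u p i * ((p : Fin d → ℝ) i - (y : Fin d → ℝ) i) ≤ _ + δ / 2
    linarith
  rw [integral_add (hint ⟨z, htY hz⟩) (integrable_const _)] at h2
  simp only [integral_const, probReal_univ, one_smul] at h2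
  linarith

end Minimax

/-! ### Existence of the forecaster and the per-round guarantee. -/

section Forecaster

variable {d : ℕ} {Y : Set (Fin d → ℝ)} {X : Type u} {ι : Type*} [Fintype ι]

lemma signedUnit_abs (σ : ℤˣ) : |((σ : ℤ) : ℝ)| = 1 := by
  rcases Int.units_eq_one_or σ with rfl | rfl <;> simp

/-- Only rounds before `t` enter the weights, so the recursive forecaster may fill the later rounds
with placeholders. -/
lemma weight_congr {H : Finset ℝ} {κ : ℝ} {E : ι → X → Y → ℝ} {x x' : ℕ → X}
    {π π' : ℕ → ProbabilityMeasure Y} {y y' : ℕ → Y} {t : ℕ} (hx : ∀ s < t, x s = x' s)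
    (hπ : ∀ s < t, π s = π' s) (hy : ∀ s < t, y s = y' s) :
    weight H κ E x π y t = weight H κ E x' π' y' t := by
  have key : ∀ (E' : X → Y → ℝ) (i : Fin d) (σ : ℤˣ),
      rawWeight H κ x π y t E' i σ = rawWeight H κ x' π' y' t E' i σ := by
    intro E' i σ
    have h : ∀ s ∈ Finset.range t,
        signedBias E' i σ (x s) (π s) (y s) = signedBias E' i σ (x' s) (π' s) (y' s) := by
      intro s hs
      rw [Finset.mem_range] at hs
      rw [hx s hs, hπ s hs, hy s hs]
    have h2 : ∀ s ∈ Finset.range t, signedBias E' i σ (x s) (π s) (y s) ^ 2 =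
        signedBias E' i σ (x' s) (π' s) (y' s) ^ 2 := fun s hs => by rw [h s hs]
    simp only [rawWeight, Finset.sum_congr rfl h, Finset.sum_congr rfl h2]
  funext e i σ
  simp only [weight, key]

/-- The coefficient of `pⁱ - yⁱ` in the objective. -/
def objectiveCoeff (q : ι → Fin d → ℤˣ → ℝ) (E : ι → X → Y → ℝ) (x : X) (p : Y) (i : Fin d) : ℝ :=
  ∑ e : ι, ∑ σ : ℤˣ, q e i σ * ((σ : ℤ) : ℝ) * E e x p

lemma objective_eq (q : ι → Fin d → ℤˣ → ℝ) (E : ι → X → Y → ℝ) (x : X)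
    (π : ProbabilityMeasure Y) (y : Y) :
    objective q E x π y = ∫ p : Y, ∑ i, objectiveCoeff q E x p i *
      ((p : Fin d → ℝ) i - (y : Fin d → ℝ) i) ∂(π : Measure Y) := by
  unfold objective objectiveCoeff
  congr 1
  funext p
  rw [Finset.sum_comm]
  simp only [Finset.sum_mul]

lemma measurable_objectiveCoeff {q : ι → Fin d → ℤˣ → ℝ} {E : ι → X → Y → ℝ}
    (hEm : ∀ e x, Measurable (E e x)) (x : X) (i : Fin d) :
    Measurable fun p => objectiveCoeff q E x p i :=
  Finset.measurable_sum _ fun e _ => Finset.measurable_sum _ fun _ _ => (hEm e x).const_mul _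

lemma exists_abs_objectiveCoeff_le (q : ι → Fin d → ℤˣ → ℝ) {E : ι → X → Y → ℝ}
    (hE : ∀ e x p, |E e x p| ≤ 1) : ∃ B, 0 ≤ B ∧ ∀ x p i, |objectiveCoeff q E x p i| ≤ B := by
  refine ⟨∑ i, ∑ e : ι, ∑ σ : ℤˣ, |q e i σ|, by positivity, fun x p i => ?_⟩
  refine le_trans ?_ (Finset.single_le_sum (f := fun i => ∑ e : ι, ∑ σ : ℤˣ, |q e i σ|)
    (fun _ _ => by positivity) (Finset.mem_univ i))
  refine (Finset.abs_sum_le_sum_abs _ _).trans (Finset.sum_le_sum fun e _ => ?_)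
  refine (Finset.abs_sum_le_sum_abs _ _).trans (Finset.sum_le_sum fun σ _ => ?_)
  rw [abs_mul, abs_mul, signedUnit_abs, mul_one]
  exact mul_le_of_le_one_right (abs_nonneg _) (hE e x p)

/-- Makes the suprema over outcomes genuine: a real `⨆` of an unbounded family would default to 0.
-/
lemma exists_abs_objective_le (hY : Y ⊆ Set.Icc 0 1) (q : ι → Fin d → ℤˣ → ℝ)
    {E : ι → X → Y → ℝ} (hE : ∀ e x p, |E e x p| ≤ 1) :
    ∃ B, ∀ x π y, |objective q E x π y| ≤ B := by
  obtain ⟨B, hB0, hB⟩ := exists_abs_objectiveCoeff_le q hE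
  refine ⟨d * B, fun x π y => ?_⟩
  rw [objective_eq, ← Real.norm_eq_abs]
  refine (norm_integral_le_of_norm_le_const (C := d * B) (Filter.Eventually.of_forall fun p =>
    ?_)).trans (by simp)
  refine (Finset.abs_sum_le_sum_abs _ _).trans
    ((Finset.sum_le_sum (g := fun _ => B) fun i _ => ?_).trans (by simp))
  rw [abs_mul]
  exact (mul_le_mul (hB x p i) (abs_apply_sub_apply_le_one hY p y i) (abs_nonneg _) hB0).trans
    (mul_one B).le

/-- `π` minimizes `sup_y objective` up to an additive error `τ`. -/
def IsApproxMinimizer (τ : ℝ) (q : ι → Fin d → ℤˣ → ℝ) (E : ι → X → Y → ℝ) (x : X)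
    (π : ProbabilityMeasure Y) : Prop :=
  ∀ π' : ProbabilityMeasure Y,
    (⨆ y', objective q E x π y') ≤ (⨆ y', objective q E x π' y') + τ

/-- The infimum over distributions is finite, hence approached within `τ > 0`, whether or not it is
attained. -/
lemma exists_isApproxMinimizer (hYn : Y.Nonempty) (hY : Y ⊆ Set.Icc 0 1) {τ : ℝ} (hτ : 0 < τ)
    (q : ι → Fin d → ℤˣ → ℝ) {E : ι → X → Y → ℝ} (hE : ∀ e x p, |E e x p| ≤ 1) (x : X) :
    ∃ π, IsApproxMinimizer τ q E x π := by
  obtain ⟨B, hB⟩ := exists_abs_objective_le hY q hE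
  have hne : Nonempty Y := hYn.to_subtype
  have : Nonempty (ProbabilityMeasure Y) := ⟨diracProba hne.some⟩
  have hbdd : BddBelow (Set.range fun π => ⨆ y', objective q E x π y') := by
    refine ⟨-B, ?_⟩
    rintro _ ⟨π, rfl⟩
    have hba : BddAbove (Set.range fun y' => objective q E x π y') :=
      ⟨B, by rintro _ ⟨y, rfl⟩; exact (abs_le.1 (hB x π y)).2⟩
    exact (abs_le.1 (hB x π hne.some)).1.trans (le_ciSup hba hne.some)
  obtain ⟨π, hπ⟩ := exists_lt_of_ciInf_lt (lt_add_of_pos_right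
    (⨅ π, ⨆ y', objective q E x π y') hτ)
  exact ⟨π, fun π' => hπ.le.trans (add_le_add_left (ciInf_le hbdd π') τ)⟩

lemma IsApproxMinimizer.objective_le (hYc : Convex ℝ Y) (hYn : Y.Nonempty)
    (hY : Y ⊆ Set.Icc 0 1) {τ : ℝ} {q : ι → Fin d → ℤˣ → ℝ} {E : ι → X → Y → ℝ}
    (hEm : ∀ e x, Measurable (E e x)) (hE : ∀ e x p, |E e x p| ≤ 1) {x : X}
    {π : ProbabilityMeasure Y} (h : IsApproxMinimizer τ q E x π) (y : Y) :
    objective q E x π y ≤ τ := by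
  obtain ⟨B, hB⟩ := exists_abs_objective_le hY q hE
  obtain ⟨C, -, hC⟩ := exists_abs_objectiveCoeff_le q hE
  have hne : Nonempty Y := hYn.to_subtype
  have hba : BddAbove (Set.range fun y' => objective q E x π y') :=
    ⟨B, by rintro _ ⟨y, rfl⟩; exact (abs_le.1 (hB x π y)).2⟩
  refine (le_ciSup hba y).trans (le_of_forall_pos_le_add fun δ hδ => ?_)
  obtain ⟨π', hπ'⟩ := exists_forall_integral_le hYc hYn hY
    (measurable_objectiveCoeff (q := q) hEm x) (hC x) hδ
  have h1 : (⨆ y', objective q E x π' y') ≤ δ := ciSup_le fun y' => by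
    rw [objective_eq]; exact hπ' y'
  have := h π'
  linarith

/-- The forecaster that selects an approximate minimizer in every round. -/
def unbiasedForecaster [Nonempty Y] (τ : ℝ) (H : Finset ℝ) (κ : ℝ) (E : ι → X → Y → ℝ) :
    Forecaster X Y
  | t, h, x =>
    @Classical.epsilon _ ⟨diracProba (Classical.arbitrary Y)⟩ fun π => IsApproxMinimizer τ
      (weight H κ E (fun s => if hs : s < t then (h ⟨s, hs⟩).1 else x)
        (fun s => if hs : s < t then
            unbiasedForecaster τ H κ E s (fun r => h ⟨r, r.2.trans hs⟩) (h ⟨s, hs⟩).1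
          else diracProba (Classical.arbitrary Y))
        (fun s => if hs : s < t then (h ⟨s, hs⟩).2 else Classical.arbitrary Y) t) E x π

lemma exists_isUnbiasedPrediction (hYn : Y.Nonempty) (hY : Y ⊆ Set.Icc 0 1) (T : ℕ) {τ : ℝ}
    (hτ : 0 < τ) (H : Finset ℝ) (κ : ℝ) {E : ι → X → Y → ℝ} (hE : ∀ e x p, |E e x p| ≤ 1) :
    ∃ F : Forecaster X Y, IsUnbiasedPrediction T τ H κ E F := by
  have : Nonempty Y := hYn.to_subtype
  refine ⟨unbiasedForecaster τ H κ E, fun x y t _ => ?_⟩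
  have hplay : IsApproxMinimizer τ
      (weight H κ E (fun s => if s < t then x s else x t)
        (fun s => if s < t then (unbiasedForecaster τ H κ E).play x y s
          else diracProba (Classical.arbitrary Y))
        (fun s => if s < t then y s else Classical.arbitrary Y) t) E (x t)
      ((unbiasedForecaster τ H κ E).play x y t) := by
    rw [Forecaster.play, unbiasedForecaster]
    exact Classical.epsilon_spec_aux _ _ (exists_isApproxMinimizer hYn hY hτ _ hE (x t))
  rwa [IsApproxMinimizer, weight_congr (x' := x) (π' := (unbiasedForecaster τ H κ E).play x y) (y' := y)
    (fun s hs => if_pos hs) (fun s hs => if_pos hs) (fun s hs => if_pos hs)] at hplay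

end Forecaster

/-! ### Second-order multiplicative weights and tuning of the rate. -/

lemma exp_sub_sq_le_one_add {x : ℝ} (hx : |x| ≤ 1 / 2) : Real.exp (x - x ^ 2) ≤ 1 + x := by
  obtain ⟨h1, h2⟩ := abs_le.1 hx
  rcases le_total 0 x with h0 | h0
  · have hz : |x - x ^ 2| ≤ 1 := abs_le.2 ⟨by nlinarith, by nlinarith⟩
    -- With z = x - x², the bound exp z ≤ 1 + z + z² has right side 1 + x - x³(2 - x).
    have := (abs_le.1 (Real.abs_exp_sub_one_sub_id_le hz)).2
    have h3 : 0 ≤ x ^ 3 * (2 - x) := mul_nonneg (pow_nonneg h0 3) (by linarith)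
    nlinarith
  · obtain ⟨a, rfl⟩ : ∃ a, x = -a := ⟨-x, by ring⟩
    have ha : 0 ≤ a := by linarith
    have hq := Real.quadratic_le_exp_of_nonneg (x := a + a ^ 2) (by positivity)
    have e : Real.exp (-a - (-a) ^ 2) = (Real.exp (a + a ^ 2))⁻¹ := by
      rw [← Real.exp_neg]; ring_nf
    rw [e]
    refine inv_le_of_inv_le₀ (by linarith) (le_trans ?_ hq)
    rw [inv_le_iff_one_le_mul₀ (by linarith)]
    -- Half of this is the excess over 1 of (1 - a)(1 + z + z²/2), where z = a + a².
    have : 0 ≤ a ^ 2 * (1 - a - a ^ 2 - a ^ 3) := by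
      refine mul_nonneg (sq_nonneg a) ?_
      have : a ^ 2 ≤ 1 / 4 := by nlinarith
      have : a ^ 3 ≤ 1 / 8 := by nlinarith
      linarith
    nlinarith

/-- The potential argument for multiplicative weights with second-order correction and several
learning rates. -/
lemma exp_le_of_secondOrder_weights {J : Type*} [Fintype J] {H : Finset ℝ}
    (hH : ∀ η ∈ H, 0 < η ∧ η ≤ 1) {g : ℕ → J → ℝ} (hg : ∀ t j, |g t j| ≤ 1) {T : ℕ} {τ : ℝ}
    (hτ : 0 ≤ τ)
    (hstep : ∀ t < T, ∑ j, (∑ η ∈ H, η * Real.exp ((η / 2) * ∑ s ∈ Finset.range t, g s j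
        - (η / 2) ^ 2 * ∑ s ∈ Finset.range t, g s j ^ 2)) * g t j ≤
      τ * ∑ j, ∑ η ∈ H, η * Real.exp ((η / 2) * ∑ s ∈ Finset.range t, g s j
        - (η / 2) ^ 2 * ∑ s ∈ Finset.range t, g s j ^ 2))
    {η : ℝ} (hη : η ∈ H) (j : J) :
    Real.exp ((η / 2) * ∑ s ∈ Finset.range T, g s j
        - (η / 2) ^ 2 * ∑ s ∈ Finset.range T, g s j ^ 2) ≤
      Fintype.card J * H.card * Real.exp (T * (τ / 2)) := by
  set w : ℕ → J → ℝ → ℝ := fun t j η => Real.exp ((η / 2) * ∑ s ∈ Finset.range t, g s j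
        - (η / 2) ^ 2 * ∑ s ∈ Finset.range t, g s j ^ 2) with hw
  have hw0 : ∀ t j η, 0 ≤ w t j η := fun t j η => (Real.exp_pos _).le
  have hsucc : ∀ t j, ∀ η ∈ H, w (t + 1) j η ≤ w t j η * (1 + η / 2 * g t j) := by
    intro t j η hη
    have hb : |η / 2 * g t j| ≤ 1 / 2 := by
      rw [abs_mul, abs_of_pos (half_pos (hH η hη).1)]
      have := hg t j
      have h3 := hH η hη
      nlinarith [abs_nonneg (g t j)]
    refine le_trans (le_of_eq ?_) (mul_le_mul_of_nonneg_left (exp_sub_sq_le_one_add hb) (hw0 _ _ _))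
    simp only [hw]
    rw [← Real.exp_add, Finset.sum_range_succ, Finset.sum_range_succ]
    ring_nf
  -- The potential omits the prefactor η: the update 1 + ηg/2 supplies it, so the increment is the
  -- sum controlled by `hstep`. Since η ≤ 1, each round multiplies the bound by at most 1 + τ/2.
  have hΦ : ∀ t ≤ T, ∑ j, ∑ η ∈ H, w t j η ≤ Fintype.card J * H.card * (1 + τ / 2) ^ t := by
    intro t
    induction t with
    | zero => intro _; simp [hw]
    | succ t ih =>
      intro ht
      have h1 : ∑ j, ∑ η ∈ H, w (t + 1) j η ≤
          ∑ j, ∑ η ∈ H, w t j η + 1 / 2 * ∑ j, (∑ η ∈ H, η * w t j η) * g t j := by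
        rw [Finset.mul_sum, ← Finset.sum_add_distrib]
        refine Finset.sum_le_sum fun j _ => ?_
        rw [Finset.sum_mul, Finset.mul_sum, ← Finset.sum_add_distrib]
        refine Finset.sum_le_sum fun η hη => (hsucc t j η hη).trans (le_of_eq (by ring))
      have h2 : ∑ j, ∑ η ∈ H, η * w t j η ≤ ∑ j, ∑ η ∈ H, w t j η :=
        Finset.sum_le_sum fun j _ => Finset.sum_le_sum fun η hη =>
          mul_le_of_le_one_left (hw0 _ _ _) (hH η hη).2
      have h3 := hstep t ht
      have h4 := mul_le_mul_of_nonneg_left h2 hτ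
      have h5 := ih (by omega)
      have h6 := mul_le_mul_of_nonneg_right h5 (show 0 ≤ 1 + τ / 2 by linarith)
      calc _ ≤ (∑ j, ∑ η ∈ H, w t j η) * (1 + τ / 2) := by linarith
        _ ≤ _ := h6
        _ = _ := by ring
  have hsingle : w T j η ≤ ∑ j, ∑ η ∈ H, w T j η :=
    (Finset.single_le_sum (f := fun η => w T j η) (fun _ _ => hw0 _ _ _) hη).trans
      (Finset.single_le_sum (f := fun j => ∑ η ∈ H, w T j η)
        (fun _ _ => Finset.sum_nonneg fun _ _ => hw0 _ _ _) (Finset.mem_univ j))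
  refine hsingle.trans ((hΦ T le_rfl).trans (mul_le_mul_of_nonneg_left ?_ (by positivity)))
  rw [Real.exp_nat_mul]
  exact pow_le_pow_left₀ (by linarith) (by linarith [Real.add_one_le_exp (τ / 2)]) T

lemma dyadicRates_pos_le_one {T : ℕ} {η : ℝ} (hη : η ∈ dyadicRates T) : 0 < η ∧ η ≤ 1 := by
  obtain ⟨j, -, rfl⟩ := Finset.mem_image.1 hη
  exact ⟨by positivity, pow_le_one₀ (by norm_num) (by norm_num)⟩

lemma card_dyadicRates_le {T : ℕ} (hT : 1 ≤ T) : (dyadicRates T).card ≤ T := by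
  refine Finset.card_image_le.trans ?_
  rw [Finset.card_range]
  exact Nat.log_lt_self 2 (by omega)

/-- Tuning of the learning rate among the dyadic ones. -/
lemma le_of_forall_dyadicRates {T : ℕ} {S V n Λ : ℝ} (hΛ : 1 ≤ Λ)
    (hVn : V ≤ n) (hn : n ≤ T)
    (h : ∀ η ∈ dyadicRates T, (η / 2) * S - (η / 2) ^ 2 * V ≤ Λ) :
    S ≤ 3 * Λ + 3 * Real.sqrt (Λ * n) := by
  have hs := Real.sqrt_nonneg (Λ * n)
  rcases le_total n Λ with hc | hc
  -- For n ≤ Λ the largest rate suffices: S ≤ 2Λ + V/2.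
  · have h1 := h 1 (Finset.mem_image.2 ⟨0, by simp, by simp⟩)
    linarith
  · have hn0 : 0 < n := by linarith
    -- Up to a constant, `r` balances Λ/η against ηn. A dyadic η with r ≤ η ≤ 2r gives S ≤ 2Λ/η +
    -- ηn/2 ≤ 3rn.
    set r := Real.sqrt (Λ / n) with hr
    have hr2 : r ^ 2 * n = Λ := by rw [hr, Real.sq_sqrt (by positivity)]; field_simp
    have hr0 : 0 < r := Real.sqrt_pos.2 (by positivity)
    have hr1 : r ≤ 1 := by
      rw [hr, Real.sqrt_le_left zero_le_one, one_pow]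
      exact div_le_one_of_le₀ hc hn0.le
    have hrn : Real.sqrt (Λ * n) = r * n := by
      rw [← hr2, show r ^ 2 * n * n = (r * n) ^ 2 by ring, Real.sqrt_sq (by positivity)]
    obtain ⟨j, hj1, hj2⟩ := exists_nat_pow_near_of_lt_one hr0 hr1
      (show (0 : ℝ) < 1 / 2 by norm_num) (by norm_num)
    -- Since nr ≥ nr² = Λ ≥ 1, the ideal rate is at least 1/T and the grid reaches far enough down.
    have hTr : 1 ≤ T * r := by
      have : 1 ≤ n * r := by
        have : n * r * 1 ≥ n * r * r := mul_le_mul_of_nonneg_left hr1 (by positivity)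
        nlinarith
      exact this.trans (mul_le_mul_of_nonneg_right hn hr0.le)
    have hjT : 2 ^ j ≤ T := by
      have h1 : (1 : ℝ) ≤ T * (1 / 2) ^ j :=
        hTr.trans (mul_le_mul_of_nonneg_left hj2 (Nat.cast_nonneg T))
      rw [one_div, inv_pow, ← div_eq_mul_inv, one_le_div (by positivity)] at h1
      exact_mod_cast h1
    have h1 := h _ (Finset.mem_image.2 ⟨j, Finset.mem_range.2
      (Nat.lt_succ_of_le (Nat.le_log_of_pow_le (by norm_num) hjT)), rfl⟩)
    set η : ℝ := (1 / 2) ^ j with hη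
    have hη0 : 0 < η := by positivity
    have hη2 : η ≤ 2 * r := by rw [pow_succ] at hj1; linarith
    have h2 : (η / 2) ^ 2 * V ≤ (η / 2) ^ 2 * n := mul_le_mul_of_nonneg_left hVn (sq_nonneg _)
    have h3 : r * (r * n) ≤ η * (r * n) := mul_le_mul_of_nonneg_right hj2 (by positivity)
    have h4 : η * (η * n) ≤ (2 * r) * (η * n) := mul_le_mul_of_nonneg_right hη2 (by positivity)
    have h5 : (η / 2) * S ≤ (η / 2) * (3 * (r * n)) := by nlinarith
    have h6 := le_of_mul_le_mul_left h5 (half_pos hη0)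
    rw [hrn]
    linarith

/-! ### Conditional bias bounds. -/

section Bias

variable {d : ℕ} {Y : Set (Fin d → ℝ)} {X : Type u} {ι : Type*} [Fintype ι]

/-- The conditional bias `𝔼_{p ∼ π}[E(x, p) (pⁱ - yⁱ)]`. -/
def bias (E : X → Y → ℝ) (i : Fin d) (x : X) (π : ProbabilityMeasure Y) (y : Y) : ℝ :=
  ∫ p : Y, E x p * ((p : Fin d → ℝ) i - (y : Fin d → ℝ) i) ∂(π : Measure Y)

lemma abs_bias_le (hY : Y ⊆ Set.Icc 0 1) {E : X → Y → ℝ} (hEm : ∀ x, Measurable (E x))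
    (hE0 : ∀ x p, 0 ≤ E x p) (hE1 : ∀ x p, E x p ≤ 1) (i : Fin d) (x : X)
    (π : ProbabilityMeasure Y) (y : Y) : |bias E i x π y| ≤ ∫ p, E x p ∂(π : Measure Y) := by
  rw [bias, ← Real.norm_eq_abs]
  refine norm_integral_le_of_norm_le (integrable_of_abs_le _ (hEm x) (B := 1) fun p => ?_)
    (Filter.Eventually.of_forall fun p => ?_)
  · rw [abs_of_nonneg (hE0 x p)]; exact hE1 x p
  · rw [Real.norm_eq_abs, abs_mul, abs_of_nonneg (hE0 x p)]
    exact mul_le_of_le_one_right (hE0 x p) (abs_apply_sub_apply_le_one hY p y i)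

lemma integral_event_le_one {E : X → Y → ℝ} (hE0 : ∀ x p, 0 ≤ E x p) (hE1 : ∀ x p, E x p ≤ 1)
    (x : X) (π : ProbabilityMeasure Y) : ∫ p, E x p ∂(π : Measure Y) ≤ 1 := by
  refine (le_abs_self _).trans ?_
  rw [← Real.norm_eq_abs]
  refine (norm_integral_le_of_norm_le_const (C := 1) (Filter.Eventually.of_forall fun p =>
    ?_)).trans (by simp)
  rw [Real.norm_eq_abs, abs_of_nonneg (hE0 x p)]
  exact hE1 x p

lemma objective_eq_sum_signedBias (hY : Y ⊆ Set.Icc 0 1) (q : ι → Fin d → ℤˣ → ℝ)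
    {E : ι → X → Y → ℝ} (hEm : ∀ e x, Measurable (E e x)) (hE : ∀ e x p, |E e x p| ≤ 1)
    (x : X) (π : ProbabilityMeasure Y) (y : Y) :
    objective q E x π y = ∑ e, ∑ i, ∑ σ, q e i σ * signedBias (E e) i σ x π y := by
  have hint : ∀ e i (c : ℝ), Integrable
      (fun p : Y => c * (E e x p * ((p : Fin d → ℝ) i - (y : Fin d → ℝ) i))) (π : Measure Y) := by
    intro e i c
    refine (integrable_of_abs_le _ (B := 1)
      ((hEm e x).mul ((measurable_coe_apply i).sub_const _)) fun p => ?_).const_mul c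
    rw [Pi.mul_apply, abs_mul]
    exact mul_le_one₀ (hE e x p) (abs_nonneg _) (abs_apply_sub_apply_le_one hY p y i)
  unfold objective signedBias
  simp only [mul_assoc]
  simp only [← mul_assoc (q _ _ _)]
  rw [integral_finsetSum _ fun e _ => integrable_finsetSum _ fun i _ =>
    integrable_finsetSum _ fun σ _ => hint e i _]
  refine Finset.sum_congr rfl fun e _ => ?_
  rw [integral_finsetSum _ fun i _ => integrable_finsetSum _ fun σ _ => hint e i _]
  refine Finset.sum_congr rfl fun i _ => ?_
  rw [integral_finsetSum _ fun σ _ => hint e i _]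
  exact Finset.sum_congr rfl fun σ _ => integral_const_mul _ _

lemma rawWeight_pos {H : Finset ℝ} (hHn : H.Nonempty) (hH : ∀ η ∈ H, 0 < η) (κ : ℝ)
    (x : ℕ → X) (π : ℕ → ProbabilityMeasure Y) (y : ℕ → Y) (t : ℕ) (E : X → Y → ℝ) (i : Fin d)
    (σ : ℤˣ) : 0 < rawWeight H κ x π y t E i σ :=
  Finset.sum_pos (fun η hη => mul_pos (hH η hη) (Real.exp_pos _)) hHn

/-- The bias guarantee of Unbiased-Prediction with dyadic rates and second-order correction. -/
lemma IsUnbiasedPrediction.abs_sum_bias_le (hYc : Convex ℝ Y) (hYn : Y.Nonempty)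
    (hY : Y ⊆ Set.Icc 0 1) {T : ℕ} (hT : 1 ≤ T) {τ : ℝ} (hτ : 0 < τ) (hτT : τ ≤ 1 / T)
    {E : ι → X → Y → ℝ} (hEm : ∀ e x, Measurable (E e x)) (hE0 : ∀ e x p, 0 ≤ E e x p)
    (hE1 : ∀ e x p, E e x p ≤ 1) {F : Forecaster X Y}
    (hF : IsUnbiasedPrediction T τ (dyadicRates T) 1 E F) (x : ℕ → X) (y : ℕ → Y) {Λ : ℝ}
    (hΛ1 : 1 ≤ Λ) (hΛ : Real.log (2 * d * Fintype.card ι * T) + 1 / 2 ≤ Λ) (e : ι) (i : Fin d) :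
    |∑ t ∈ Finset.range T, bias (E e) i (x t) (F.play x y t) (y t)| ≤ 3 * Λ + 3 * Real.sqrt (Λ *
      ∑ t ∈ Finset.range T, ∫ p, E e (x t) p ∂(F.play x y t : Measure Y)) := by
  have hEa : ∀ e x p, |E e x p| ≤ 1 := fun e x p => by
    rw [abs_of_nonneg (hE0 e x p)]; exact hE1 e x p
  set π := F.play x y with hπ
  let g : ℕ → ι × Fin d × ℤˣ → ℝ := fun t j =>
    signedBias (E j.1) j.2.1 j.2.2 (x t) (π t) (y t)
  have hgb : ∀ t j, |g t j| = |bias (E j.1) j.2.1 (x t) (π t) (y t)| := fun t j => by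
    simp only [g, signedBias, bias, abs_mul, signedUnit_abs, one_mul]
  have hgE : ∀ t j, |g t j| ≤ ∫ p, E j.1 (x t) p ∂(π t : Measure Y) := fun t j =>
    (hgb t j).le.trans (abs_bias_le hY (hEm _) (hE0 _) (hE1 _) _ _ _ _)
  have hE1' : ∀ t e, ∫ p, E e (x t) p ∂(π t : Measure Y) ≤ 1 := fun t e =>
    integral_event_le_one (hE0 _) (hE1 _) _ _
  have hg : ∀ t j, |g t j| ≤ 1 := fun t j => (hgE t j).trans (hE1' t j.1)
  have hHn : (dyadicRates T).Nonempty := ⟨1, Finset.mem_image.2 ⟨0, by simp, by simp⟩⟩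
  have hstep : ∀ t < T, ∑ j : ι × Fin d × ℤˣ,
      rawWeight (dyadicRates T) 1 x π y t (E j.1) j.2.1 j.2.2 * g t j ≤
      τ * ∑ j : ι × Fin d × ℤˣ, rawWeight (dyadicRates T) 1 x π y t (E j.1) j.2.1 j.2.2 := by
    intro t ht
    have h1 := IsApproxMinimizer.objective_le hYc hYn hY hEm hEa
      (fun π' => hF x y t ht π') (y t)
    rw [objective_eq_sum_signedBias hY _ hEm hEa] at h1
    simp only [Fintype.sum_prod_type]
    set W := ∑ e' : ι, ∑ i' : Fin d, ∑ σ' : ℤˣ,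
      rawWeight (dyadicRates T) 1 x π y t (E e') i' σ' with hW
    have hWpos : 0 < W := by
      have : Nonempty ι := ⟨e⟩
      have : Nonempty (Fin d) := ⟨i⟩
      exact Finset.sum_pos (fun e _ => Finset.sum_pos (fun i _ => Finset.sum_pos (fun σ _ =>
        rawWeight_pos hHn (fun η hη => (dyadicRates_pos_le_one hη).1) _ _ _ _ _ _ _ _)
        Finset.univ_nonempty) Finset.univ_nonempty) Finset.univ_nonempty
    refine le_trans (le_of_eq ?_) (mul_le_mul_of_nonneg_right h1 hWpos.le)
    simp only [Finset.sum_mul]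
    refine Finset.sum_congr rfl fun e _ => Finset.sum_congr rfl fun i _ =>
      Finset.sum_congr rfl fun σ _ => ?_
    rw [weight, ← hπ, ← hW]
    field_simp
    rfl
  simp only [rawWeight, one_mul] at hstep
  have hmain : ∀ σ : ℤˣ, ∑ t ∈ Finset.range T, g t (e, i, σ) ≤ 3 * Λ + 3 * Real.sqrt (Λ *
      ∑ t ∈ Finset.range T, ∫ p, E e (x t) p ∂(π t : Measure Y)) := by
    intro σ
    refine le_of_forall_dyadicRates (T := T) (V := ∑ t ∈ Finset.range T, g t (e, i, σ) ^ 2) hΛ1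
      (Finset.sum_le_sum fun t _ => ?_)
      ((Finset.sum_le_sum fun t _ => hE1' t e).trans (by simp)) fun η hη => ?_
    -- As |g| ≤ 1, g² ≤ |g| ≤ the probability of the event, so the variance term is at most the
    -- expected count.
    · rw [← sq_abs]
      refine le_trans ?_ (hgE t (e, i, σ))
      exact pow_le_of_le_one (abs_nonneg _) (hg t _) (by norm_num)
    · have h1 := exp_le_of_secondOrder_weights (fun η hη => dyadicRates_pos_le_one hη) hg hτ.le
        hstep hη (e, i, σ)
      have hT0 : (0 : ℝ) < T := by exact_mod_cast hT
      have hd : (0 : ℝ) < d := by exact_mod_cast i.pos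
      have hι : (0 : ℝ) < Fintype.card ι := by exact_mod_cast Fintype.card_pos_iff.2 ⟨e⟩
      -- The signs contribute the 2 and the rates at most T; τ ≤ 1/T gives Tτ/2 ≤ 1/2, the additive
      -- term in `hΛ`.
      have h2 : (Fintype.card (ι × Fin d × ℤˣ) : ℝ) * (dyadicRates T).card *
          Real.exp (T * (τ / 2)) ≤ 2 * d * Fintype.card ι * T * Real.exp (1 / 2) := by
        refine mul_le_mul ?_ (Real.exp_le_exp.2 ?_) (Real.exp_pos _).le (by positivity)
        · have e1 : (Fintype.card (ι × Fin d × ℤˣ) : ℝ) = 2 * d * Fintype.card ι := by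
            simp; ring
          rw [e1]
          exact mul_le_mul_of_nonneg_left (by exact_mod_cast card_dyadicRates_le hT)
            (by positivity)
        · rw [le_div_iff₀ hT0] at hτT
          linarith
      have h3 := (Real.le_log_iff_exp_le (by positivity)).2 (h1.trans h2)
      rw [Real.log_mul (by positivity) (Real.exp_pos _).ne', Real.log_exp] at h3
      exact h3.trans hΛ
  rw [abs_le]
  constructor
  · have := hmain (-1)
    simp only [g, signedBias, Units.val_neg, Units.val_one, Int.cast_neg, Int.cast_one,
      neg_mul, one_mul, Finset.sum_neg_distrib] at this
    exact neg_le.1 this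
  · have := hmain 1
    simpa only [g, signedBias, bias, Units.val_one, Int.cast_one, one_mul] using this

end Bias

/-! ### From coordinatewise biases to losses. -/

section Lipschitz

variable {d : ℕ} {Y : Set (Fin d → ℝ)}

/-- By convexity, a sum of scaled differences is again one scaled difference; a negative scalar
swaps the two points. -/
lemma exists_eq_smul_sub_of_mem_vectorSpan {V : Type*} [AddCommGroup V] [Module ℝ V] {Y : Set V}
    (hYc : Convex ℝ Y) (hYn : Y.Nonempty) {z : V} (hz : z ∈ vectorSpan ℝ Y) :
    ∃ c : ℝ, 0 ≤ c ∧ ∃ y ∈ Y, ∃ y' ∈ Y, z = c • (y - y') := by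
  refine Submodule.span_induction ?_ ?_ ?_ ?_ hz
  · rintro _ ⟨y, hy, y', hy', rfl⟩
    exact ⟨1, zero_le_one, y, hy, y', hy', by simp⟩
  · obtain ⟨y, hy⟩ := hYn
    exact ⟨0, le_rfl, y, hy, y, hy, by simp⟩
  · rintro _ _ - - ⟨a, ha, y, hy, y', hy', rfl⟩ ⟨b, hb, w, hw, w', hw', rfl⟩
    rcases (add_nonneg ha hb).eq_or_lt with h | h
    · have ha0 : a = 0 := by linarith
      have hb0 : b = 0 := by linarith
      exact ⟨0, le_rfl, y, hy, y', hy', by simp [ha0, hb0]⟩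
    · refine ⟨a + b, h.le, (a / (a + b)) • y + (b / (a + b)) • w,
        hYc hy hw (by positivity) (by positivity) (by field_simp),
        (a / (a + b)) • y' + (b / (a + b)) • w',
        hYc hy' hw' (by positivity) (by positivity) (by field_simp), ?_⟩
      simp only [smul_sub, smul_add, smul_smul, mul_div_cancel₀ _ h.ne']
      abel
  · rintro t _ - ⟨a, ha, y, hy, y', hy', rfl⟩
    rcases le_total 0 t with ht | ht
    · exact ⟨t * a, mul_nonneg ht ha, y, hy, y', hy', by rw [smul_smul]⟩
    · refine ⟨-t * a, mul_nonneg (by linarith) ha, y', hy', y, hy, ?_⟩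
      rw [← neg_sub y y', smul_neg, smul_smul, neg_mul, neg_smul, neg_neg]

/-- The Lipschitz condition says nothing about `r` transversally to `Y`; along the span it extends
by homogeneity. -/
lemma abs_sum_mul_le_of_mem_vectorSpan (hYc : Convex ℝ Y) (hYn : Y.Nonempty) {r : Fin d → ℝ}
    {L : ℝ} (hr : ∀ y ∈ Y, ∀ y' ∈ Y, |∑ i, r i * (y i - y' i)| ≤ L * ‖y - y'‖)
    {z : Fin d → ℝ} (hz : z ∈ vectorSpan ℝ Y) : |∑ i, r i * z i| ≤ L * ‖z‖ := by
  obtain ⟨c, hc, y, hy, y', hy', rfl⟩ := exists_eq_smul_sub_of_mem_vectorSpan hYc hYn hz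
  have e : ∑ i, r i * (c • (y - y')) i = c * ∑ i, r i * (y i - y' i) := by
    rw [Finset.mul_sum]
    exact Finset.sum_congr rfl fun i _ => by simp; ring
  rw [e, abs_mul, norm_smul, Real.norm_eq_abs, mul_left_comm]
  exact mul_le_mul_of_nonneg_left (hr y hy y' hy') (abs_nonneg c)

/-- The bias vector averages E(x,p)(p - y), which stays in a closed convex subspace. -/
lemma bias_mem_vectorSpan {X : Type u} (hY : Y ⊆ Set.Icc 0 1) {E : X → Y → ℝ}
    (hEm : ∀ x, Measurable (E x)) (hE : ∀ x p, |E x p| ≤ 1) (x : X) (π : ProbabilityMeasure Y)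
    (y : Y) : (fun i => bias E i x π y) ∈ vectorSpan ℝ Y := by
  have hint : ∀ i, Integrable (fun p : Y => E x p * ((p : Fin d → ℝ) i - (y : Fin d → ℝ) i))
      (π : Measure Y) := fun i =>
    integrable_of_abs_le _ (B := 1) ((hEm x).mul ((measurable_coe_apply i).sub_const _))
      fun p => by
        rw [abs_mul]
        exact mul_le_one₀ (hE x p) (abs_nonneg _) (abs_apply_sub_apply_le_one hY p y i)
  have e : (fun i => bias E i x π y) =
      ∫ p : Y, E x p • ((p : Fin d → ℝ) - (y : Fin d → ℝ)) ∂(π : Measure Y) := by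
    funext i
    rw [eval_integral fun i => by simpa using hint i]
    simp [bias]
  rw [e]
  refine Convex.integral_mem (vectorSpan ℝ Y).convex (Submodule.closed_of_finiteDimensional _)
    (Filter.Eventually.of_forall fun p => Submodule.smul_mem _ _
      (vsub_mem_vectorSpan ℝ p.2 y.2)) ?_
  exact Integrable.of_eval fun i => by simpa using hint i

/-- A coordinatewise bound on the cumulative bias bounds the cumulative bias in the loss. -/
lemma abs_sum_mul_bias_le {X : Type u} (hYc : Convex ℝ Y) (hYn : Y.Nonempty)
    (hY : Y ⊆ Set.Icc 0 1) {r : Fin d → ℝ}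
    {L : ℝ} (hL : 0 ≤ L) (hr : ∀ y ∈ Y, ∀ y' ∈ Y, |∑ i, r i * (y i - y' i)| ≤ L * ‖y - y'‖)
    {E : X → Y → ℝ} (hEm : ∀ x, Measurable (E x)) (hE : ∀ x p, |E x p| ≤ 1) (T : ℕ) (x : ℕ → X)
    (π : ℕ → ProbabilityMeasure Y) (y : ℕ → Y) {M : ℝ} (hM0 : 0 ≤ M)
    (hM : ∀ i, |∑ t ∈ Finset.range T, bias E i (x t) (π t) (y t)| ≤ M) :
    |∑ t ∈ Finset.range T, ∑ i, r i * bias E i (x t) (π t) (y t)| ≤ L * M := by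
  rw [Finset.sum_comm]
  simp only [← Finset.mul_sum]
  have hmem : (∑ t ∈ Finset.range T, fun i => bias E i (x t) (π t) (y t)) ∈ vectorSpan ℝ Y :=
    Submodule.sum_mem _ fun t _ => bias_mem_vectorSpan hY hEm hE _ _ _
  have h := abs_sum_mul_le_of_mem_vectorSpan hYc hYn hr hmem
  simp only [Finset.sum_apply] at h
  refine h.trans (mul_le_mul_of_nonneg_left ?_ hL)
  rw [pi_norm_le_iff_of_nonneg hM0]
  intro i
  simpa only [Finset.sum_apply, Real.norm_eq_abs] using hM i

end Lipschitz

/-! ### Decision events and the decomposition of regret. -/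

section DecisionSwap

variable {d : ℕ} {Y : Set (Fin d → ℝ)} {X : Type u} {A : Type v}

lemma decisionEvent_nonneg (𝓛 : Finset (A → Y → ℝ)) (𝒞 : Finset (X → A))
    (k : (A → Y → ℝ) → Y → A) (e x p) : 0 ≤ decisionEvent 𝓛 𝒞 k e x p := by
  rcases e with ⟨ℓ, a⟩ | ⟨ℓ, a, b, c⟩ <;> simp only [decisionEvent] <;> split_ifs <;> norm_num

lemma decisionEvent_le_one (𝓛 : Finset (A → Y → ℝ)) (𝒞 : Finset (X → A))
    (k : (A → Y → ℝ) → Y → A) (e x p) : decisionEvent 𝓛 𝒞 k e x p ≤ 1 := by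
  rcases e with ⟨ℓ, a⟩ | ⟨ℓ, a, b, c⟩ <;> simp only [decisionEvent] <;> split_ifs <;> norm_num

lemma abs_decisionEvent_le_one (𝓛 : Finset (A → Y → ℝ)) (𝒞 : Finset (X → A))
    (k : (A → Y → ℝ) → Y → A) (e x p) : |decisionEvent 𝓛 𝒞 k e x p| ≤ 1 := by
  rw [abs_of_nonneg (decisionEvent_nonneg 𝓛 𝒞 k e x p)]
  exact decisionEvent_le_one 𝓛 𝒞 k e x p

lemma measurable_decisionEvent {𝓛 : Finset (A → Y → ℝ)} {𝒞 : Finset (X → A)}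
    {k : (A → Y → ℝ) → Y → A} (hk : ∀ ℓ ∈ 𝓛, IsBestResponse ℓ (k ℓ)) (e x) :
    Measurable (decisionEvent 𝓛 𝒞 k e x) := by
  rcases e with ⟨ℓ, a⟩ | ⟨ℓ, a, b, c⟩
  · exact Measurable.ite ((hk ℓ ℓ.2).measurable a) measurable_const measurable_const
  · exact Measurable.ite (((hk ℓ ℓ.2).measurable a).inter (MeasurableSet.const _))
      measurable_const measurable_const

lemma sum_decisionEvent_inl_mul [Fintype A] {𝓛 : Finset (A → Y → ℝ)} (𝒞 : Finset (X → A))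
    (k : (A → Y → ℝ) → Y → A) (ℓ : 𝓛) (x : X) (p : Y) (v : A → ℝ) :
    ∑ a, decisionEvent 𝓛 𝒞 k (.inl (ℓ, a)) x p * v a = v (k ℓ p) := by
  classical
  rw [Finset.sum_eq_single (k ℓ p)]
  · simp [decisionEvent]
  · intro a _ ha
    simp [decisionEvent, ha.symm]
  · simp

/-- Exactly one pair fires: the policy is indexed by the first action, which then determines the
second. -/
lemma sum_decisionEvent_inr_mul [Fintype A] {𝓛 : Finset (A → Y → ℝ)} {𝒞 : Finset (X → A)}
    (k : (A → Y → ℝ) → Y → A) (ℓ : 𝓛) (c : A → 𝒞) (x : X) (p : Y) (v : A × A → ℝ) :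
    ∑ j : A × A, decisionEvent 𝓛 𝒞 k (.inr (ℓ, j.1, j.2, c j.1)) x p * v j =
      v (k ℓ p, (c (k ℓ p) : X → A) x) := by
  classical
  rw [Finset.sum_eq_single (k ℓ p, (c (k ℓ p) : X → A) x)]
  · simp [decisionEvent]
  · rintro ⟨a, b⟩ _ hab
    have : ¬ (k ℓ p = a ∧ (c a : X → A) x = b) := by
      rintro ⟨rfl, rfl⟩; exact hab rfl
    simp [decisionEvent, this]
  · simp

lemma IsBestResponse.measurable_comp [Finite A] {ℓ : A → Y → ℝ} {k : Y → A}
    (hk : IsBestResponse ℓ k) (G : A → ℝ) : Measurable fun p => G (k p) := by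
  let _ : MeasurableSpace A := ⊤
  have : Measurable k := measurable_to_countable' fun a => hk.measurable a
  exact measurable_from_top.comp this

/-- The expected regret is the average of the expected one-round regrets. -/
lemma integral_swapRegret [Finite A] {ℓ : A → Y → ℝ} {k : Y → A} (hk : IsBestResponse ℓ k)
    (T : ℕ) (c : A → X → A) (x : ℕ → X) (y : ℕ → Y) (π : ℕ → ProbabilityMeasure Y) :
    ∫ p : Fin T → Y, swapRegret T ℓ k c x y p ∂(Measure.pi fun t : Fin T => (π t : Measure Y)) =
      (1 / (T : ℝ)) * ∑ t ∈ Finset.range T,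
        ∫ p, (ℓ (k p) (y t) - ℓ (c (k p) (x t)) (y t)) ∂(π t : Measure Y) := by
  have hm : ∀ t, Measurable fun p => ℓ (k p) (y t) - ℓ (c (k p) (x t)) (y t) := fun t =>
    hk.measurable_comp fun a => ℓ a (y t) - ℓ (c a (x t)) (y t)
  have hint : ∀ t, Integrable (fun p => ℓ (k p) (y t) - ℓ (c (k p) (x t)) (y t))
      (π t : Measure Y) := fun t => by
    obtain ⟨B, hB⟩ := (Set.finite_range fun a => |ℓ a (y t) - ℓ (c a (x t)) (y t)|).bddAbove
    exact integrable_of_abs_le _ (hm t) fun p => hB ⟨k p, rfl⟩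
  unfold swapRegret
  rw [integral_const_mul, integral_finsetSum _ fun t _ => ?_]
  · congr 1
    rw [← Fin.sum_univ_eq_sum_range fun t =>
      ∫ p, (ℓ (k p) (y t) - ℓ (c (k p) (x t)) (y t)) ∂(π t : Measure Y)]
    refine Finset.sum_congr rfl fun t _ => ?_
    exact integral_comp_eval (μ := fun t : Fin T => (π t : Measure Y)) (i := t)
      (hm t).aestronglyMeasurable
  · exact integrable_comp_eval (μ := fun t : Fin T => (π t : Measure Y)) (i := t) (hint t)

/-- Cauchy–Schwarz handles the square roots, and `hmT` absorbs the additive Λ terms. With m = |A| it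
serves both single actions and pairs. -/
lemma sum_sqrt_bound {J : Type*} [Fintype J] {n : J → ℝ} (hn : ∀ j, 0 ≤ n j) {Λ T m : ℝ}
    (hΛ : 0 ≤ Λ) (hnT : ∑ j, n j ≤ T) (hm : 0 ≤ m) (hJ : (Fintype.card J : ℝ) ≤ m ^ 2)
    (hmT : m ^ 2 * Λ ≤ T) :
    ∑ j, (3 * Λ + 3 * Real.sqrt (Λ * n j)) ≤ 6 * (m * Real.sqrt (Λ * T)) := by
  have hT : 0 ≤ T := le_trans (by positivity) hmT
  have h1 : ∑ j, Real.sqrt (Λ * n j) ≤ m * Real.sqrt (Λ * T) := by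
    refine le_of_sq_le_sq ?_ (by positivity)
    rw [mul_pow, Real.sq_sqrt (by positivity)]
    refine sq_sum_le_card_mul_sum_sq.trans ?_
    refine mul_le_mul hJ ?_ (by positivity) (sq_nonneg m)
    rw [Finset.sum_congr rfl fun j _ => Real.sq_sqrt (mul_nonneg hΛ (hn j)), ← Finset.mul_sum]
    exact mul_le_mul_of_nonneg_left hnT hΛ
  have h2 : Fintype.card J * Λ ≤ m * Real.sqrt (Λ * T) := by
    refine (mul_le_mul_of_nonneg_right hJ hΛ).trans ?_
    rw [sq, mul_assoc]
    refine mul_le_mul_of_nonneg_left (Real.le_sqrt_of_sq_le ?_) hm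
    nlinarith
  rw [Finset.sum_add_distrib, ← Finset.mul_sum Finset.univ fun j => Real.sqrt (Λ * n j)]
  simp only [Finset.sum_const, Finset.card_univ, nsmul_eq_mul]
  linarith

/-- The losses of the best response and of a deviation, on the outcome and on the prediction. -/
lemma IsBestResponse.regret_le {ℓ : A → Y → ℝ} {k : Y → A} (hk : IsBestResponse ℓ k)
    {r : A → Fin d → ℝ} (hr : ∀ a (y : Y), ℓ a y = ∑ i, r a i * (y : Fin d → ℝ) i) (p y : Y)
    (b : A) : ℓ (k p) y - ℓ b y ≤
      ∑ i, r b i * ((p : Fin d → ℝ) i - (y : Fin d → ℝ) i) -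
      ∑ i, r (k p) i * ((p : Fin d → ℝ) i - (y : Fin d → ℝ) i) := by
  -- Optimality at the prediction allows ℓ(k p, p) - ℓ(b, p) ≤ 0 to be dropped.
  have := hk.argmin p b
  simp only [mul_sub, Finset.sum_sub_distrib, ← hr]
  linarith

variable [Fintype A]

/-- The cumulative regret in terms of the cumulative conditional biases. -/
lemma sum_integral_regret_le (hY : Y ⊆ Set.Icc 0 1)
    {𝓛 : Finset (A → Y → ℝ)} {𝒞 : Finset (X → A)} {k : (A → Y → ℝ) → Y → A}
    (hk : ∀ ℓ ∈ 𝓛, IsBestResponse ℓ (k ℓ)) (ℓ : 𝓛) {r : A → Fin d → ℝ}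
    (hr : ∀ a (y : Y), (ℓ : A → Y → ℝ) a y = ∑ i, r a i * (y : Fin d → ℝ) i) (c : A → 𝒞)
    (x : X) (π : ProbabilityMeasure Y) (y : Y) :
    ∫ p, ((ℓ : A → Y → ℝ) (k ℓ p) y - (ℓ : A → Y → ℝ) ((c (k ℓ p) : X → A) x) y)
      ∂(π : Measure Y) ≤
    ∑ j : A × A, ∑ i, r j.2 i *
        bias (decisionEvent 𝓛 𝒞 k (.inr (ℓ, j.1, j.2, c j.1))) i x π y -
      ∑ a, ∑ i, r a i * bias (decisionEvent 𝓛 𝒞 k (.inl (ℓ, a))) i x π y := by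
  have hint : ∀ e i (b : A), Integrable (fun p : Y => r b i * (decisionEvent 𝓛 𝒞 k e x p *
      ((p : Fin d → ℝ) i - (y : Fin d → ℝ) i))) (π : Measure Y) := by
    intro e i b
    refine (integrable_of_abs_le _ (B := 1)
      ((measurable_decisionEvent hk e x).mul ((measurable_coe_apply i).sub_const _))
        fun p => ?_).const_mul _
    rw [Pi.mul_apply, abs_mul]
    exact mul_le_one₀ (abs_decisionEvent_le_one 𝓛 𝒞 k e x p) (abs_nonneg _)
      (abs_apply_sub_apply_le_one hY p y i)
  have hint2 : Integrable (fun p : Y => ∑ j : A × A, ∑ i, r j.2 i *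
      (decisionEvent 𝓛 𝒞 k (.inr (ℓ, j.1, j.2, c j.1)) x p *
        ((p : Fin d → ℝ) i - (y : Fin d → ℝ) i))) (π : Measure Y) :=
    integrable_finsetSum _ fun j _ => integrable_finsetSum _ fun i _ => hint _ i _
  have hint1 : Integrable (fun p : Y => ∑ a, ∑ i, r a i *
      (decisionEvent 𝓛 𝒞 k (.inl (ℓ, a)) x p *
        ((p : Fin d → ℝ) i - (y : Fin d → ℝ) i))) (π : Measure Y) :=
    integrable_finsetSum _ fun j _ => integrable_finsetSum _ fun i _ => hint _ i _
  have hreg : Integrable (fun p => (ℓ : A → Y → ℝ) (k ℓ p) y -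
      (ℓ : A → Y → ℝ) ((c (k ℓ p) : X → A) x) y) (π : Measure Y) := by
    obtain ⟨B, hB⟩ := (Set.finite_range fun a =>
      |(ℓ : A → Y → ℝ) a y - (ℓ : A → Y → ℝ) ((c a : X → A) x) y|).bddAbove
    exact integrable_of_abs_le _ ((hk ℓ ℓ.2).measurable_comp fun a =>
      (ℓ : A → Y → ℝ) a y - (ℓ : A → Y → ℝ) ((c a : X → A) x) y) fun p => hB ⟨k ℓ p, rfl⟩
  refine (integral_mono hreg (hint2.sub hint1) fun p => ?_).trans (le_of_eq ?_)
  · refine ((hk ℓ ℓ.2).regret_le hr p y _).trans (le_of_eq ?_)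
    have h2 := sum_decisionEvent_inr_mul k ℓ c x p fun j =>
      ∑ i, r j.2 i * ((p : Fin d → ℝ) i - (y : Fin d → ℝ) i)
    have h1 := sum_decisionEvent_inl_mul 𝒞 k ℓ x p fun a =>
      ∑ i, r a i * ((p : Fin d → ℝ) i - (y : Fin d → ℝ) i)
    simp only [Pi.sub_apply]
    rw [← h2, ← h1]
    simp only [Finset.mul_sum, mul_left_comm]
  · simp only [Pi.sub_apply]
    rw [integral_sub hint2 hint1, integral_finsetSum _ fun j _ =>
      integrable_finsetSum _ fun i _ => hint _ i _, integral_finsetSum _ fun j _ =>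
      integrable_finsetSum _ fun i _ => hint _ i _]
    congr 1
    · refine Finset.sum_congr rfl fun j _ => ?_
      rw [integral_finsetSum _ fun i _ => hint _ i _]
      exact Finset.sum_congr rfl fun i _ => integral_const_mul _ _
    · refine Finset.sum_congr rfl fun j _ => ?_
      rw [integral_finsetSum _ fun i _ => hint _ i _]
      exact Finset.sum_congr rfl fun i _ => integral_const_mul _ _

end DecisionSwap

/-! ### Summing over events and counting them. -/

section Regret

variable {d : ℕ} {Y : Set (Fin d → ℝ)} {X : Type u} {A : Type v} [Fintype A]

/-- Two Lipschitz comparisons over ‖p - y‖ ≤ 1. This trivial bound settles short horizons, and it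
scales with `L`, unlike the bound 1 from the range of the losses. -/
lemma integral_regret_le_two_mul (hY : Y ⊆ Set.Icc 0 1) {L : ℝ} (hL : 0 ≤ L) {ℓ : A → Y → ℝ}
    {k : Y → A} (hk : IsBestResponse ℓ k) {r : A → Fin d → ℝ}
    (hr : ∀ a (y : Y), ℓ a y = ∑ i, r a i * (y : Fin d → ℝ) i)
    (hrL : ∀ a, ∀ y ∈ Y, ∀ y' ∈ Y, |∑ i, r a i * (y i - y' i)| ≤ L * ‖y - y'‖)
    (c : A → A) (π : ProbabilityMeasure Y) (y : Y) :
    ∫ p, (ℓ (k p) y - ℓ (c (k p)) y) ∂(π : Measure Y) ≤ 2 * L := by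
  have hle : ∀ p : Y, ℓ (k p) y - ℓ (c (k p)) y ≤ 2 * L := fun p => by
    have hn : ‖(p : Fin d → ℝ) - (y : Fin d → ℝ)‖ ≤ 1 :=
      (pi_norm_le_iff_of_nonneg zero_le_one).2 fun i => abs_apply_sub_apply_le_one hY p y i
    have h0 := hk.regret_le hr p y (c (k p))
    have h1 := (abs_le.1 (hrL (k p) p p.2 y y.2)).1
    have h2 := (abs_le.1 (hrL (c (k p)) p p.2 y y.2)).2
    nlinarith
  obtain ⟨B, hB⟩ := (Set.finite_range fun a => |ℓ a y - ℓ (c a) y|).bddAbove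
  refine (integral_mono (integrable_of_abs_le _ (hk.measurable_comp fun a => ℓ a y - ℓ (c a) y)
    fun p => hB ⟨k p, rfl⟩) (integrable_const (2 * L)) hle).trans (by simp)

lemma sum_inl_integral_decisionEvent {𝓛 : Finset (A → Y → ℝ)} {𝒞 : Finset (X → A)}
    {k : (A → Y → ℝ) → Y → A} (hk : ∀ ℓ ∈ 𝓛, IsBestResponse ℓ (k ℓ)) (ℓ : 𝓛) (T : ℕ)
    (x : ℕ → X) (π : ℕ → ProbabilityMeasure Y) :
    ∑ a, ∑ t ∈ Finset.range T, ∫ p, decisionEvent 𝓛 𝒞 k (.inl (ℓ, a)) (x t) p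
      ∂(π t : Measure Y) = T := by
  rw [Finset.sum_comm, Finset.sum_congr rfl (g := fun _ => (1 : ℝ))]
  · simp
  · intro t _
    rw [← integral_finsetSum _ fun a _ => integrable_of_abs_le _ (measurable_decisionEvent hk _ _)
      (abs_decisionEvent_le_one 𝓛 𝒞 k _ _)]
    have := fun p => sum_decisionEvent_inl_mul 𝒞 k ℓ (x t) p fun _ => 1
    simp only [mul_one] at this
    simp [this]

lemma sum_inr_integral_decisionEvent {𝓛 : Finset (A → Y → ℝ)} {𝒞 : Finset (X → A)}
    {k : (A → Y → ℝ) → Y → A} (hk : ∀ ℓ ∈ 𝓛, IsBestResponse ℓ (k ℓ)) (ℓ : 𝓛) (c : A → 𝒞) (T : ℕ)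
    (x : ℕ → X) (π : ℕ → ProbabilityMeasure Y) :
    ∑ j : A × A, ∑ t ∈ Finset.range T,
      ∫ p, decisionEvent 𝓛 𝒞 k (.inr (ℓ, j.1, j.2, c j.1)) (x t) p ∂(π t : Measure Y) = T := by
  rw [Finset.sum_comm, Finset.sum_congr rfl (g := fun _ => (1 : ℝ))]
  · simp
  · intro t _
    rw [← integral_finsetSum _ fun a _ => integrable_of_abs_le _ (measurable_decisionEvent hk _ _)
      (abs_decisionEvent_le_one 𝓛 𝒞 k _ _)]
    have := fun p => sum_decisionEvent_inr_mul k ℓ c (x t) p fun _ => 1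
    simp only [mul_one] at this
    simp [this]

/-- Decision swap regret from bounds on the conditional biases of all decision events. -/
lemma average_regret_le (hYc : Convex ℝ Y) (hYn : Y.Nonempty) (hY : Y ⊆ Set.Icc 0 1)
    {L : ℝ} (hL : 0 ≤ L) {𝓛 : Finset (A → Y → ℝ)} {𝒞 : Finset (X → A)}
    {k : (A → Y → ℝ) → Y → A} (hk : ∀ ℓ ∈ 𝓛, IsBestResponse ℓ (k ℓ)) (ℓ : 𝓛)
    (hℓ : IsLinearLoss L (ℓ : A → Y → ℝ)) (c : A → 𝒞) {T : ℕ} (hT : 1 ≤ T) (x : ℕ → X)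
    (π : ℕ → ProbabilityMeasure Y) (y : ℕ → Y) {Λ : ℝ} (hΛ : 0 ≤ Λ)
    (hbias : ∀ e i, |∑ t ∈ Finset.range T, bias (decisionEvent 𝓛 𝒞 k e) i (x t) (π t) (y t)| ≤
      3 * Λ + 3 * Real.sqrt (Λ * ∑ t ∈ Finset.range T,
        ∫ p, decisionEvent 𝓛 𝒞 k e (x t) p ∂(π t : Measure Y))) :
    (1 / (T : ℝ)) * ∑ t ∈ Finset.range T,
        ∫ p, ((ℓ : A → Y → ℝ) (k ℓ p) (y t) - (ℓ : A → Y → ℝ) ((c (k ℓ p) : X → A) (x t)) (y t))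
          ∂(π t : Measure Y) ≤
      12 * (L * (Fintype.card A * Real.sqrt (Λ / T))) := by
  obtain ⟨r, hr⟩ := hℓ.linear
  have hrL : ∀ a, ∀ y ∈ Y, ∀ y' ∈ Y, |∑ i, r a i * (y i - y' i)| ≤ L * ‖y - y'‖ := by
    intro a y hy y' hy'
    have := hℓ.lipschitz a ⟨y, hy⟩ ⟨y', hy'⟩
    rwa [hr, hr, ← Finset.sum_sub_distrib, Finset.sum_congr rfl fun i _ => (mul_sub _ _ _).symm]
      at this
  have hT0 : (0 : ℝ) < T := by exact_mod_cast hT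
  set m : ℝ := (Fintype.card A : ℝ) with hm
  have hm0 : 0 ≤ m := Nat.cast_nonneg _
  have hsq : Real.sqrt (Λ * T) = T * Real.sqrt (Λ / T) := by
    rw [show Λ * T = T ^ 2 * (Λ / T) by field_simp, Real.sqrt_mul (sq_nonneg _),
      Real.sqrt_sq hT0.le]
  rw [one_div, inv_mul_le_iff₀ hT0]
  -- For T < m²Λ the target is already at least 12L, so the trivial bound 2L suffices.
  rcases le_or_gt (m ^ 2 * Λ) T with hc | hc
  · have hn : ∀ e, 0 ≤ ∑ t ∈ Finset.range T,
        ∫ p, decisionEvent 𝓛 𝒞 k e (x t) p ∂(π t : Measure Y) := fun e =>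
      Finset.sum_nonneg fun t _ => integral_nonneg (decisionEvent_nonneg 𝓛 𝒞 k e (x t))
    have hb : ∀ e a, |∑ t ∈ Finset.range T, ∑ i, r a i *
        bias (decisionEvent 𝓛 𝒞 k e) i (x t) (π t) (y t)| ≤
        L * (3 * Λ + 3 * Real.sqrt (Λ * ∑ t ∈ Finset.range T,
          ∫ p, decisionEvent 𝓛 𝒞 k e (x t) p ∂(π t : Measure Y))) := fun e a =>
      abs_sum_mul_bias_le hYc hYn hY hL (hrL a) (measurable_decisionEvent hk e)
        (abs_decisionEvent_le_one 𝓛 𝒞 k e) T x π y (by positivity) (hbias e)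
    have h1 := Finset.sum_le_sum fun (t : ℕ) (_ : t ∈ Finset.range T) =>
      sum_integral_regret_le hY hk ℓ hr c (x t) (π t) (y t)
    rw [Finset.sum_sub_distrib, Finset.sum_comm,
      Finset.sum_comm (s := Finset.range T) (t := (Finset.univ : Finset A))] at h1
    have h2 := Finset.sum_le_sum fun (j : A × A) (_ : j ∈ Finset.univ) =>
      (abs_le.1 (hb (.inr (ℓ, j.1, j.2, c j.1)) j.2)).2
    have h3 := Finset.sum_le_sum fun (a : A) (_ : a ∈ Finset.univ) =>
      (abs_le.1 (hb (.inl (ℓ, a)) a)).1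
    rw [Finset.sum_neg_distrib] at h3
    rw [← Finset.mul_sum] at h2 h3
    have h4 := mul_le_mul_of_nonneg_left (sum_sqrt_bound
      (fun j : A × A => hn (.inr (ℓ, j.1, j.2, c j.1))) hΛ
      (sum_inr_integral_decisionEvent hk ℓ c T x π).le hm0 (by simp [hm, sq]) hc) hL
    have hA : m ≤ m ^ 2 := by
      rw [hm]; exact_mod_cast Nat.le_self_pow two_ne_zero _
    have h5 := mul_le_mul_of_nonneg_left (sum_sqrt_bound
      (fun a : A => hn (.inl (ℓ, a))) hΛ
      (sum_inl_integral_decisionEvent hk ℓ T x π).le hm0 hA hc) hL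
    rw [hsq] at h4 h5
    linarith
  · have h1 : 1 ≤ m * Real.sqrt (Λ / T) := by
      rw [← Real.sqrt_sq hm0, ← Real.sqrt_mul (sq_nonneg _), Real.one_le_sqrt, ← mul_div_assoc,
        one_le_div hT0]
      exact hc.le
    have h2 := Finset.sum_le_sum fun (t : ℕ) (_ : t ∈ Finset.range T) =>
      integral_regret_le_two_mul hY hL (hk ℓ ℓ.2) hr hrL
        (fun a => (c a : X → A) (x t)) (π t) (y t)
    rw [Finset.sum_const, Finset.card_range, nsmul_eq_mul] at h2
    refine h2.trans (mul_le_mul_of_nonneg_left ?_ hT0.le)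
    nlinarith [mul_le_mul_of_nonneg_left h1 hL]

/-- The logarithm of the number of (event, coordinate, sign, rate) tuples. -/
lemma log_card_le {d m l n T : ℕ} (hd : 1 ≤ d) (hm : 2 ≤ m) (hl : 1 ≤ l) (hn : 1 ≤ n)
    (hT : 1 ≤ T) :
    Real.log (2 * d * ((l * m + l * (m * (m * n)) : ℕ) : ℝ) * T) + 1 / 2 ≤
      5 * Real.log ((d : ℝ) * m * l * n * T) ∧
    1 ≤ 5 * Real.log ((d : ℝ) * m * l * n * T) := by
  set N : ℕ := d * m * l * n * T with hN
  have e : (d : ℝ) * m * l * n * T = (N : ℝ) := by push_cast [hN]; ring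
  have hmN : m * (d * l * n * T) = N := by rw [hN]; ring
  have hP : 1 ≤ d * l * n * T := Nat.mul_pos (Nat.mul_pos (Nat.mul_pos hd hl) hn) hT
  have hN2 : 2 ≤ N := by nlinarith
  -- The count is at most 4Nm, with 4 ≤ N² and m ≤ N. A fifth log N ≥ 1/2 pays for the additive 1/2.
  have hcard : 2 * d * (l * m + l * (m * (m * n))) * T ≤ N ^ 4 := by
    have h1 : l * m ≤ l * (m * (m * n)) := by
      refine Nat.mul_le_mul_left _ (Nat.le_mul_of_pos_right _ (by positivity))
    calc 2 * d * (l * m + l * (m * (m * n))) * T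
        ≤ 2 * d * (l * (m * (m * n)) + l * (m * (m * n))) * T := by gcongr
      _ = 4 * (N * m) := by rw [hN]; ring
      _ ≤ N ^ 2 * (N * N) := by
        gcongr
        · nlinarith
        · rw [← hmN]; exact Nat.le_mul_of_pos_right _ hP
      _ = N ^ 4 := by ring
  have hpos : 0 < 2 * d * (l * m + l * (m * (m * n))) * T := by positivity
  rw [e]
  have hlog2 : 1 / 2 ≤ Real.log N := by
    have h1 := Real.log_two_gt_d9
    have h2 : Real.log 2 ≤ Real.log N := Real.log_le_log (by norm_num) (by exact_mod_cast hN2)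
    linarith
  have h3 : Real.log (2 * d * ((l * m + l * (m * (m * n)) : ℕ) : ℝ) * T) ≤ 4 * Real.log N := by
    have h := Real.log_le_log (Nat.cast_pos.2 hpos) (Nat.cast_le (α := ℝ).2 hcard)
    rw [Nat.cast_pow, Real.log_pow] at h
    push_cast at h ⊢
    exact h
  constructor <;> linarith

end Regret

end

/-! ### Assembly. -/

theorem mainTheorem6 :
    ∃ K : ℝ, 0 < K ∧
      ∀ (d : ℕ) (Y : Set (Fin d → ℝ)), Convex ℝ Y → Y.Nonempty → Y ⊆ Set.Icc 0 1 →
      ∀ (X : Type u) (A : Type v) [Fintype A]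
        (lip : ℝ), 0 ≤ lip →
      ∀ (𝓛 : Finset (A → Y → ℝ)), (∀ ℓ ∈ 𝓛, IsLinearLoss lip ℓ) →
      ∀ (𝒞 : Finset (X → A)) (BR : (A → Y → ℝ) → Y → A),
        (∀ ℓ ∈ 𝓛, IsBestResponse ℓ (BR ℓ)) →
      ∀ (T : ℕ), 1 ≤ T →
      ∀ (τ : ℝ), 0 < τ → τ ≤ 1 / (T : ℝ) →
        (∃ F : Forecaster X Y, IsDecisionSwap T τ 𝓛 𝒞 BR F) ∧
        ∀ F : Forecaster X Y, IsDecisionSwap T τ 𝓛 𝒞 BR F →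
          ∀ (x : ℕ → X) (y : ℕ → Y),
            HasExpectedDecisionSwapRegret T 𝓛 𝒞 BR x y (F.play x y)
              (K * (lip * (Fintype.card A : ℝ) *
                Real.sqrt (Real.log ((d : ℝ) * (Fintype.card A : ℝ) * (𝓛.card : ℝ) *
                  (𝒞.card : ℝ) * (T : ℝ)) / (T : ℝ)))) := by
  -- 36 = 12 · 3: the 12 comes from `average_regret_le`, and 3 ≥ √5 accounts for Λ = 5ν.
  refine ⟨36, by norm_num, ?_⟩
  intro d Y hYc hYn hY X A _ lip hlip 𝓛 h𝓛 𝒞 BR hBR T hT τ hτ hτT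
  refine ⟨exists_isUnbiasedPrediction hYn hY T hτ _ _ (abs_decisionEvent_le_one 𝓛 𝒞 BR), ?_⟩
  intro F hF x y ℓ hℓ c hc
  rw [integral_swapRegret (hBR ℓ hℓ)]
  have hrhs : 0 ≤ 36 * (lip * (Fintype.card A : ℝ) *
      Real.sqrt (Real.log ((d : ℝ) * (Fintype.card A : ℝ) * (𝓛.card : ℝ) *
        (𝒞.card : ℝ) * (T : ℝ)) / (T : ℝ))) := by positivity
  rcases Nat.eq_zero_or_pos d with rfl | hd
  · obtain ⟨r, hr⟩ := (h𝓛 ℓ hℓ).linear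
    simp [hr]
  have a₀ : A := BR ℓ (y 0)
  -- A single action has no regret. It is split off because the logarithm may then be 0, while the
  -- count needs |A| ≥ 2.
  rcases (Nat.succ_le_of_lt (Fintype.card_pos_iff.2 ⟨a₀⟩)).eq_or_lt with hA | hA
  · have : Subsingleton A := Fintype.card_le_one_iff_subsingleton.1 hA.symm.le
    have h0 : ∀ t p, ℓ (BR ℓ p) (y t) - ℓ (c (BR ℓ p) (x t)) (y t) = 0 := fun t p => by
      rw [Subsingleton.elim (c (BR ℓ p) (x t)) (BR ℓ p), sub_self]
    simpa only [h0, integral_zero, Finset.sum_const_zero, mul_zero] using hrhs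
  have hlogs := log_card_le hd hA (Finset.card_pos.2 ⟨ℓ, hℓ⟩)
    (Finset.card_pos.2 ⟨c a₀, hc a₀⟩) hT
  set ν := Real.log ((d : ℝ) * (Fintype.card A : ℝ) * (𝓛.card : ℝ) * (𝒞.card : ℝ) * (T : ℝ))
    with hν
  refine (average_regret_le hYc hYn hY hlip hBR ⟨ℓ, hℓ⟩ (h𝓛 ℓ hℓ) (fun a => ⟨c a, hc a⟩) hT x
    (F.play x y) y (Λ := 5 * ν) (by linarith [hlogs.2]) fun e i =>
      IsUnbiasedPrediction.abs_sum_bias_le hYc hYn hY hT hτ hτT (measurable_decisionEvent hBR)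
        (decisionEvent_nonneg 𝓛 𝒞 BR) (decisionEvent_le_one 𝓛 𝒞 BR) hF x y hlogs.2
        (by simpa using hlogs.1) e i).trans ?_
  have h5 : Real.sqrt (5 * ν / T) ≤ 3 * Real.sqrt (ν / T) := by
    rw [mul_div_assoc, Real.sqrt_mul (by norm_num)]
    exact mul_le_mul_of_nonneg_right (Real.sqrt_le_iff.2 ⟨by norm_num, by norm_num⟩)
      (Real.sqrt_nonneg _)
  have h6 := mul_le_mul_of_nonneg_left h5
    (mul_nonneg hlip (Nat.cast_nonneg (α := ℝ) (Fintype.card A)))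
  linarith
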